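/- **Theorem (Target Reachability).** *Setting.* Consider $\dot x=f(x,u)=J(x)\nabla H(x)+G(x)u$, with states $x$ in a compact set $\mathcal X\subset\mathbb R^n$, inputs in a compact set $U\subset\mathbb R^m$ with $0\in U$, $H:\mathbb R^n\to\mathbb R$, and $J(x)$ skew-symmetric for $x\in\mathcal X$. Admissible controls on $(0,T]$ are piecewise continuous and $U$-valued; controls on $(0,\infty)$ are admissible if they are so on every $(0,T]$. Write $\phi(t,x,u)$ for the state at time $t$ of the trajectory from $x\in\mathcal X$ under $u$, defined as long as this trajectory stays in $\mathcal X$. Zero-input trajectories from $\mathcal X$ exist in $\mathcal X$ for all $t\ge0$. For $E\in\mathbb R$ put $\Sigma_E=\{x\in\mathcal X:H(x)=E\}$; an *ergodic component* of $\Sigma_E$ is the support of an ergodic invariant probability measure of the zero-input flow on $\Sigma_E$. Let $S_0\subseteq\mathcal X$ be compact and let $S_{\rm tgt}\subseteq\mathcal X$ be nonempty, compact and connected. Put $H_{\min}=\min_{S_{\rm tgt}}H$, $H_{\max}=\max_{S_{\rm tgt}}H$, $$\Delta H(x)=\Big|H(x)-\tfrac{H_{\max}+H_{\min}}2\Big|-\tfrac{H_{\max}-H_{\min}}2,\qquad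 H^\epsilon_{\rm tgt}=\{x\in\mathcal X:\Delta H(x)\le-\epsilon\},\qquad c=\sup_{S_0}\Delta H .$$ *Assumptions.* There are $L_H,L>0$ and $0<\epsilon<\frac{H_{\max}-H_{\min}}2$ such that: (A1) $H$ is differentiable at every point of $\mathcal X$, $\nabla H$ is continuous on $\mathcal X$, $\|\nabla H\|\le L_H$ on $\mathcal X$, and $|H(x)-H(y)|\le L_H\|x-y\|$ for $x,y\in\mathcal X$ (the last bound is automatic if $\mathcal X$ is convex); (A2) $\|f(x,u)-f(y,u)\|\le L\|x-y\|$ for all $x,y\in\mathcal X$, $u\in U$; (A3) for every $E\in(H_{\min},H_{\max})$, $\operatorname{int}(S_{\rm tgt})$ meets every ergodic component of $\Sigma_E$; (A4) for every $x\in\mathcal X\setminus H^\epsilon_{\rm tgt}$ there are $T>0$ and an admissible $u$ on $(0,T]$ with $\phi(T,x,u)\in H^\epsilon_{\rm tgt}$; (A5) $\inf_{x\in\mathcal X\setminus H^\epsilon_{\rm tgt}}v_\epsilon(x)>0$, where $v_\epsilon(x)=\sup_u\dfrac{\Delta H(x)-\Delta H(\phi(T_\epsilon(x,u),x,u))}{T_\epsilon(x,u)}$,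 the supremum is over admissible $u$ on $(0,\infty)$ whose trajectory from $x$ reaches $H^\epsilon_{\rm tgt}$, and $T_\epsilon(x,u)=\inf\{t>0:\phi(t,x,u)\in H^\epsilon_{\rm tgt}\}$. *Assignment set.* Let $\mathcal K=\{(x_i,r_i,u_i)\}_{i=1}^N$ with $x_i\in\mathcal X$, $r_i>0$, $u_i$ admissible on $(0,\tau_i]$, $\tau_i>0$. With $\mathcal B_r(x)$ the closed Euclidean ball, let $\mathrm{Supp}(\mathcal K)=\bigcup_i\mathcal B_{r_i}(x_i)$. Assume that from every state of $\mathcal X\cap\mathcal B_{r_i}(x_i)$ the trajectory under $u_i$ exists in $\mathcal X$ on $[0,\tau_i]$, and, for some $v_0>0$: 1. $\Delta H(\phi(\tau_i,x_i,u_i))+v_0\tau_i+L_Hr_ie^{L\tau_i}\le\Delta H(x_i)-L_Hr_i$ for every $i$; 2. if $x\in\mathcal X\setminus H^\epsilon_{\rm tgt}$ and $\Delta H(x)\le c$, then $H(x)\in H(\mathrm{Supp}(\mathcal K))$; 3. for every $E\in H(\mathrm{Supp}(\mathcal K))$ that equals $H(x)$ for some $x$ as in 2, $\operatorname{int}(\mathrm{Supp}(\mathcal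 K))$ meets every ergodic component of $\Sigma_E$. *Policy.* The chain policy $\pi_{\mathcal K}$ acts at switching times, starting at time $0$. In a state $x\in\mathrm{Supp}(\mathcal K)$ it applies, for time $\tau_i$, the snippet $u_i$ with $i$ minimizing $\|x-x_i\|/r_i$ (ties broken by any fixed rule); in a state $x\notin\mathrm{Supp}(\mathcal K)$ it applies the zero input until the state enters $\mathrm{Supp}(\mathcal K)$, or forever if it never does. Let $\phi(t,x_0,\pi_{\mathcal K})$ be the state at time $t$ under the resulting concatenated control signal. *Conclusion.* For Lebesgue-almost every $x_0\in S_0$ there is a finite $t>0$ such that the trajectory exists in $\mathcal X$ on $[0,t]$ and $\phi(t,x_0,\pi_{\mathcal K})\in S_{\rm tgt}$. -/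

import Mathlib

open MeasureTheory Set Filter Topology
open scoped ENNReal

/-- Data of a lossless Hamiltonian control system `x' = J(x) ∇H(x) + G(x) u`
with compact state set `X ⊆ ℝⁿ` and compact input set `U ⊆ ℝᵐ` containing the zero input. -/
structure HamiltonianSystem (n m : ℕ) where
  X : Set (EuclideanSpace ℝ (Fin n))
  U : Set (EuclideanSpace ℝ (Fin m))
  H : EuclideanSpace ℝ (Fin n) → ℝ
  J : EuclideanSpace ℝ (Fin n) → Matrix (Fin n) (Fin n) ℝ
  G : EuclideanSpace ℝ (Fin n) → Matrix (Fin n) (Fin m) ℝ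
  isCompact_X : IsCompact X
  isCompact_U : IsCompact U
  zero_mem_U : 0 ∈ U
  skew_J : ∀ x ∈ X, (J x).transpose = -(J x)

namespace HamiltonianSystem

variable {n m : ℕ} (S : HamiltonianSystem n m)

/-- The right-hand side `f(x,u) = J(x) ∇H(x) + G(x) u`. -/
noncomputable def f (x : EuclideanSpace ℝ (Fin n)) (u : EuclideanSpace ℝ (Fin m)) :
    EuclideanSpace ℝ (Fin n) :=
  WithLp.toLp 2 ((S.J x).mulVec (gradient S.H x).ofLp + (S.G x).mulVec u.ofLp)

/-- `u` is an admissible control on `(0,T]`: it is `U`-valued and piecewise continuous there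
(continuous off a finite set, with finite one-sided limits). -/
def IsAdmissible (u : ℝ → EuclideanSpace ℝ (Fin m)) (T : ℝ) : Prop :=
  (∀ t ∈ Ioc 0 T, u t ∈ S.U) ∧
  (∃ F : Set ℝ, F.Finite ∧ ∀ t ∈ Ioo 0 T \ F, ContinuousAt u t) ∧
  (∀ t ∈ Ico 0 T, ∃ l, Tendsto u (𝓝[>] t) (𝓝 l)) ∧
  (∀ t ∈ Ioc 0 T, ∃ l, Tendsto u (𝓝[<] t) (𝓝 l))

/-- `y` is a trajectory in the state set `X` on `[0,T]` with initial state `x` and input `u`: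
it is continuous and solves the differential equation except at finitely many times. -/
def IsTrajectory (u : ℝ → EuclideanSpace ℝ (Fin m)) (T : ℝ) (x : EuclideanSpace ℝ (Fin n))
    (y : ℝ → EuclideanSpace ℝ (Fin n)) : Prop :=
  y 0 = x ∧ ContinuousOn y (Icc 0 T) ∧ (∀ t ∈ Icc 0 T, y t ∈ S.X) ∧
  ∃ F : Set ℝ, F.Finite ∧ ∀ t ∈ Ioo 0 T \ F, HasDerivAt y (S.f (y t) (u t)) t

/-- The state `φ(t,x,u)` is defined: the trajectory exists in `X` on `[0,t]`. -/
def Defined (t : ℝ) (x : EuclideanSpace ℝ (Fin n)) (u : ℝ → EuclideanSpace ℝ (Fin m)) : Prop :=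
  ∃ y, S.IsTrajectory u t x y

open Classical in
/-- The state `φ(t,x,u)` at time `t`. The value `x` is used where it is not defined. -/
noncomputable def φ (t : ℝ) (x : EuclideanSpace ℝ (Fin n))
    (u : ℝ → EuclideanSpace ℝ (Fin m)) : EuclideanSpace ℝ (Fin n) :=
  if h : S.Defined t x u then h.choose t else x

/-- The zero-input flow `φ(t,x,0)`. -/
noncomputable def φ₀ (t : ℝ) (x : EuclideanSpace ℝ (Fin n)) : EuclideanSpace ℝ (Fin n) :=
  S.φ t x (fun _ => 0)

/-- Zero-input trajectories that start in `X` exist for all future times and stay in `X`. -/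
def ZeroInputInvariant : Prop :=
  ∀ x ∈ S.X, ∀ t : ℝ, 0 ≤ t → S.Defined t x (fun _ => 0)

/-- `H` is continuously differentiable on `X`, its gradient is bounded by `LH` there, and
`LH` is a Lipschitz constant of `H` on `X` (which is automatic if `X` is convex). -/
def BoundedGradient (LH : ℝ) : Prop :=
  0 < LH ∧ (∀ x ∈ S.X, DifferentiableAt ℝ S.H x) ∧ ContinuousOn (gradient S.H) S.X ∧
  (∀ x ∈ S.X, ‖gradient S.H x‖ ≤ LH) ∧
  (∀ x ∈ S.X, ∀ y ∈ S.X, |S.H x - S.H y| ≤ LH * ‖x - y‖)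

/-- `f(·,u)` is `L`-Lipschitz on `X` for every input value `u ∈ U`. -/
def LipschitzDynamics (L : ℝ) : Prop :=
  0 < L ∧ ∀ u ∈ S.U, ∀ x ∈ S.X, ∀ y ∈ S.X, ‖S.f x u - S.f y u‖ ≤ L * ‖x - y‖

/-! ### Energy layers and their ergodic components -/

/-- The energy layer `Σ_E`. -/
def layer (E : ℝ) : Set (EuclideanSpace ℝ (Fin n)) := {x ∈ S.X | S.H x = E}

/-- `μ` is an ergodic invariant probability measure of the zero-input flow on `Σ_E`. -/
def IsErgodicMeasure (E : ℝ) (μ : Measure (EuclideanSpace ℝ (Fin n))) : Prop :=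
  IsProbabilityMeasure μ ∧ μ (S.layer E)ᶜ = 0 ∧
  (∀ t : ℝ, 0 ≤ t → MeasurePreserving (S.φ₀ t) μ μ) ∧
  ∀ A : Set (EuclideanSpace ℝ (Fin n)), MeasurableSet A → A ⊆ S.layer E →
    (∀ t : ℝ, 0 ≤ t → S.φ₀ t '' A ⊆ A) → μ A = 0 ∨ μ A = 1

/-- `K` is an ergodic component of `Σ_E`: the support of an ergodic measure on `Σ_E`. -/
def IsErgodicComponent (E : ℝ) (K : Set (EuclideanSpace ℝ (Fin n))) : Prop :=
  ∃ μ : Measure (EuclideanSpace ℝ (Fin n)), S.IsErgodicMeasure E μ ∧ K = μ.support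

/-! ### The target set, the energy distance and the energy decrease rate -/

/-- `H_min`, the smallest energy on the target set. -/
noncomputable def Hmin (Stgt : Set (EuclideanSpace ℝ (Fin n))) : ℝ := sInf (S.H '' Stgt)

/-- `H_max`, the largest energy on the target set. -/
noncomputable def Hmax (Stgt : Set (EuclideanSpace ℝ (Fin n))) : ℝ := sSup (S.H '' Stgt)

/-- The signed energy distance `ΔH(x) = |H(x) - (H_max + H_min)/2| - (H_max - H_min)/2`. -/
noncomputable def ΔH (Stgt : Set (EuclideanSpace ℝ (Fin n)))
    (x : EuclideanSpace ℝ (Fin n)) : ℝ :=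
  |S.H x - (S.Hmax Stgt + S.Hmin Stgt) / 2| - (S.Hmax Stgt - S.Hmin Stgt) / 2

/-- The shrunken target energy band `{x ∈ X | ΔH(x) ≤ -ε}`. -/
def band (Stgt : Set (EuclideanSpace ℝ (Fin n))) (ε : ℝ) : Set (EuclideanSpace ℝ (Fin n)) :=
  {x ∈ S.X | S.ΔH Stgt x ≤ -ε}

/-- On every layer whose energy lies strictly between `H_min` and `H_max`, the interior of the
target set meets every ergodic component. -/
def TargetMeetsComponents (Stgt : Set (EuclideanSpace ℝ (Fin n))) : Prop :=
  ∀ E ∈ Ioo (S.Hmin Stgt) (S.Hmax Stgt), ∀ K, S.IsErgodicComponent E K →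
    (interior Stgt ∩ K).Nonempty

/-- Every state outside the shrunken band can be steered into it. -/
def BandReachable (Stgt : Set (EuclideanSpace ℝ (Fin n))) (ε : ℝ) : Prop :=
  ∀ x ∈ S.X \ S.band Stgt ε, ∃ T : ℝ, 0 < T ∧ ∃ u : ℝ → EuclideanSpace ℝ (Fin m),
    S.IsAdmissible u T ∧ S.Defined T x u ∧ S.φ T x u ∈ S.band Stgt ε

/-- The positive times at which `φ(·,x,u)` is in the shrunken band. -/
def hitTimes (Stgt : Set (EuclideanSpace ℝ (Fin n))) (ε : ℝ) (x : EuclideanSpace ℝ (Fin n))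
    (u : ℝ → EuclideanSpace ℝ (Fin m)) : Set ℝ :=
  {t | 0 < t ∧ S.Defined t x u ∧ S.φ t x u ∈ S.band Stgt ε}

/-- The average decrease rate `v_ε(x,u)` up to the first hitting time `T_ε(x,u)`
(used only for controls that do hit the band). -/
noncomputable def rate (Stgt : Set (EuclideanSpace ℝ (Fin n))) (ε : ℝ)
    (x : EuclideanSpace ℝ (Fin n)) (u : ℝ → EuclideanSpace ℝ (Fin m)) : ℝ :=
  (S.ΔH Stgt x - S.ΔH Stgt (S.φ (sInf (S.hitTimes Stgt ε x u)) x u)) /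
    sInf (S.hitTimes Stgt ε x u)

/-- The best decrease rate `v_ε(x)`, the supremum over all controls on `(0,∞)` that hit. -/
noncomputable def bestRate (Stgt : Set (EuclideanSpace ℝ (Fin n))) (ε : ℝ)
    (x : EuclideanSpace ℝ (Fin n)) : EReal :=
  ⨆ (u : ℝ → EuclideanSpace ℝ (Fin m)) (_ : ∀ T : ℝ, 0 < T → S.IsAdmissible u T)
    (_ : (S.hitTimes Stgt ε x u).Nonempty), ((S.rate Stgt ε x u : ℝ) : EReal)

/-- The infimum of the best decrease rates over all states outside the band is positive. -/
def UniformPositiveRate (Stgt : Set (EuclideanSpace ℝ (Fin n))) (ε : ℝ) : Prop :=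
  0 < ⨅ x ∈ S.X \ S.band Stgt ε, S.bestRate Stgt ε x

/-- The states outside the shrunken band whose energy distance is at most `sup_{S₀} ΔH`. -/
def relevant (S₀ Stgt : Set (EuclideanSpace ℝ (Fin n))) (ε : ℝ) :
    Set (EuclideanSpace ℝ (Fin n)) :=
  {x ∈ S.X | S.ΔH Stgt x ≤ sSup (S.ΔH Stgt '' S₀)} \ S.band Stgt ε

end HamiltonianSystem

/-- A finite assignment set: centers, radii and admissible control snippets. -/
structure AssignmentSet {n m : ℕ} (S : HamiltonianSystem n m) where
  N : ℕ
  center : Fin N → EuclideanSpace ℝ (Fin n)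
  radius : Fin N → ℝ
  duration : Fin N → ℝ
  signal : Fin N → ℝ → EuclideanSpace ℝ (Fin m)
  center_mem : ∀ i, center i ∈ S.X
  radius_pos : ∀ i, 0 < radius i
  duration_pos : ∀ i, 0 < duration i
  admissible : ∀ i, S.IsAdmissible (signal i) (duration i)

namespace AssignmentSet

variable {n m : ℕ} {S : HamiltonianSystem n m} (K : AssignmentSet S)

/-- The support, the union of the closed balls of the assignment set. -/
def supp : Set (EuclideanSpace ℝ (Fin n)) :=
  ⋃ i, Metric.closedBall (K.center i) (K.radius i)

/-- Each snippet, applied from a state of its ball, is executable: it keeps the state in `X`. -/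
def Executable : Prop :=
  ∀ i, ∀ y ∈ S.X ∩ Metric.closedBall (K.center i) (K.radius i),
    S.Defined (K.duration i) y (K.signal i)

/-- `ι` is an index map of `K`: on the support it picks a minimizer of the normalized distance
(with any rule to break ties), elsewhere it picks the default control, encoded by `none`. -/
def IsIndexMap (ι : EuclideanSpace ℝ (Fin n) → Option (Fin K.N)) : Prop :=
  ∀ x ∈ S.X,
    (x ∈ K.supp → ∃ i, ι x = some i ∧
      ∀ j, ‖x - K.center i‖ / K.radius i ≤ ‖x - K.center j‖ / K.radius j) ∧
    (x ∉ K.supp → ι x = none)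

/-- The control signal that the chain policy selects at the state `x`. -/
noncomputable def policy (ι : EuclideanSpace ℝ (Fin n) → Option (Fin K.N))
    (x : EuclideanSpace ℝ (Fin n)) : ℝ → EuclideanSpace ℝ (Fin m) :=
  match ι x with
  | some i => K.signal i
  | none => fun _ => 0

/-- How long the selected signal is applied: a snippet for its duration, the zero input until
the state enters the support (forever if it never does). -/
noncomputable def dwell (ι : EuclideanSpace ℝ (Fin n) → Option (Fin K.N))
    (x : EuclideanSpace ℝ (Fin n)) : ℝ≥0∞ :=
  match ι x with
  | some i => ENNReal.ofReal (K.duration i)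
  | none => ⨅ (t : ℝ) (_ : 0 < t ∧ S.φ₀ t x ∈ K.supp), ENNReal.ofReal t

/-- The state at the `k`-th switching time. -/
noncomputable def switchState (ι : EuclideanSpace ℝ (Fin n) → Option (Fin K.N))
    (x : EuclideanSpace ℝ (Fin n)) : ℕ → EuclideanSpace ℝ (Fin n)
  | 0 => x
  | k + 1 => S.φ (K.dwell ι (switchState ι x k)).toReal (switchState ι x k)
      (K.policy ι (switchState ι x k))

/-- The `k`-th switching time (`∞` after a signal that is applied forever). -/
noncomputable def switchTime (ι : EuclideanSpace ℝ (Fin n) → Option (Fin K.N))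
    (x : EuclideanSpace ℝ (Fin n)) : ℕ → ℝ≥0∞
  | 0 => 0
  | k + 1 => switchTime ι x k + K.dwell ι (K.switchState ι x k)

open Classical in
/-- The control signal on `(0,∞)` that the chain policy induces from the initial state `x`:
the concatenation of the selected signals. -/
noncomputable def policyControl (ι : EuclideanSpace ℝ (Fin n) → Option (Fin K.N))
    (x : EuclideanSpace ℝ (Fin n)) (t : ℝ) : EuclideanSpace ℝ (Fin m) :=
  if h : ∃ k, K.switchTime ι x k < ENNReal.ofReal t ∧
      ENNReal.ofReal t ≤ K.switchTime ι x (k + 1) then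
    K.policy ι (K.switchState ι x h.choose) (t - (K.switchTime ι x h.choose).toReal)
  else 0

/-- Local energy decrease at every triple of the assignment set. -/
def LocalDecrease (Stgt : Set (EuclideanSpace ℝ (Fin n))) (LH L v₀ : ℝ) : Prop :=
  ∀ i, S.ΔH Stgt (S.φ (K.duration i) (K.center i) (K.signal i)) + v₀ * K.duration i
      + LH * K.radius i * Real.exp (L * K.duration i)
    ≤ S.ΔH Stgt (K.center i) - LH * K.radius i

/-- The support covers every relevant energy level. -/
def EnergyCoverage (S₀ Stgt : Set (EuclideanSpace ℝ (Fin n))) (ε : ℝ) : Prop :=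
  ∀ x ∈ S.relevant S₀ Stgt ε, S.H x ∈ S.H '' K.supp

/-- The interior of the support meets every ergodic component of every relevant covered layer. -/
def ErgodicCoverage (S₀ Stgt : Set (EuclideanSpace ℝ (Fin n))) (ε : ℝ) : Prop :=
  ∀ E ∈ S.H '' K.supp ∩ S.H '' S.relevant S₀ Stgt ε, ∀ C, S.IsErgodicComponent E C →
    (interior K.supp ∩ C).Nonempty

end AssignmentSet

/-!
The zero-input flow preserves the energy `H`, since `J` is skew-symmetric. Its trajectories form a
continuous semiflow on the compact set `X` (Grönwall's estimate, `IsTrajectory.norm_sub_le`), so the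
closure of a tail of a trajectory is a compact forward invariant subset of one energy layer. On it
there is an invariant probability measure (Krylov–Bogoliubov), and an extreme point of the compact
set of such measures is ergodic (`exists_ergodic_probabilityMeasure`). The support of this measure
is an ergodic component inside the closure of the trajectory. Hence every zero-input trajectory
enters each open set that meets all ergodic components of its layer
(`exists_φ₀_mem_of_meets_components`). This holds for every initial state, not only for almost every
one.

Under the chain policy, the energy distance `ΔH` is constant while the zero input is applied and
drops by at least `v₀ τᵢ` during the snippet `uᵢ` (`AssignmentSet.ΔH_snippet_le`). As `ΔH` is bounded
below and there are finitely many snippets, only finitely many are applied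
(`AssignmentSet.exists_dwell_eq_top`). After the last of them the zero input is applied forever and
the trajectory stays off the support. If its energy were outside the shrunken band, the
coverage assumptions would make it enter the interior of the support. So its energy lies strictly
between `H_min` and `H_max`, and the trajectory enters the interior of the target set.
-/

/-! ### Ergodic measures of a continuous semiflow on a compact space -/

section Ergodic

open BoundedContinuousFunction ProbabilityTheory

variable {Y : Type*} [TopologicalSpace Y] [MeasurableSpace Y] [BorelSpace Y]

lemma measurePreserving_of_integral_comp_eq [HasOuterApproxClosed Y] {g : Y → Y}
    (hg : Continuous g) (μ : Measure Y) [IsFiniteMeasure μ]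
    (h : ∀ f : Y →ᵇ ℝ, ∫ y, f (g y) ∂μ = ∫ y, f y ∂μ) : MeasurePreserving g μ μ := by
  refine ⟨hg.measurable, ?_⟩
  refine ext_of_forall_integral_eq_of_IsFiniteMeasure fun f => ?_
  rw [integral_map hg.aemeasurable f.continuous.aestronglyMeasurable, h]

/-- The time averages of a bounded function along an orbit are almost invariant under a shift of
the orbit by `t`. -/
lemma abs_intervalIntegral_shift_sub_le {h : ℝ → ℝ} (hh : Continuous h) {C t k : ℝ}
    (hC : ∀ s, ‖h s‖ ≤ C) (ht : 0 ≤ t) :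
    |(∫ s in (0:ℝ)..k, h (s + t)) - ∫ s in (0:ℝ)..k, h s| ≤ 2 * C * t := by
  have hi : ∀ a b : ℝ, IntervalIntegrable h volume a b := fun a b => hh.intervalIntegrable a b
  have h1 : (∫ s in (0:ℝ)..k, h (s + t)) = ∫ s in t..(k + t), h s := by
    rw [intervalIntegral.integral_comp_add_right, zero_add]
  have h2 : (∫ s in t..(k + t), h s) - (∫ s in (0:ℝ)..k, h s)
      = (∫ s in k..(k + t), h s) - ∫ s in (0:ℝ)..t, h s := by
    have e1 := intervalIntegral.integral_add_adjacent_intervals (hi 0 t) (hi t (k + t))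
    have e2 := intervalIntegral.integral_add_adjacent_intervals (hi 0 k) (hi k (k + t))
    linarith
  have b1 := intervalIntegral.norm_integral_le_of_norm_le_const (a := k) (b := k + t)
    (f := h) (C := C) fun s _ => hC s
  have b2 := intervalIntegral.norm_integral_le_of_norm_le_const (a := 0) (b := t)
    (f := h) (C := C) fun s _ => hC s
  rw [h1, h2]
  rw [Real.norm_eq_abs] at b1 b2
  simp only [add_sub_cancel_left, sub_zero, abs_of_nonneg ht] at b1 b2
  calc _ ≤ _ := abs_sub _ _
    _ ≤ C * t + C * t := add_le_add b1 b2
    _ = _ := by ring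

/-- **Krylov–Bogoliubov**: a weak limit of the uniform distributions on longer and longer orbit
segments is an invariant measure. -/
theorem exists_invariant_probabilityMeasure [CompactSpace Y] [T2Space Y] [Nonempty Y]
    (φ : ℝ → Y → Y) (hadd : ∀ s t y, 0 ≤ s → 0 ≤ t → φ (s + t) y = φ t (φ s y))
    (hcont : ∀ t, 0 ≤ t → Continuous (φ t))
    (horb : ∀ y, ContinuousOn (fun t => φ t y) (Ici 0)) :
    ∃ μ : ProbabilityMeasure Y, ∀ t, 0 ≤ t → ∀ f : Y →ᵇ ℝ,
      ∫ y, f (φ t y) ∂(μ : Measure Y) = ∫ y, f y ∂(μ : Measure Y) := by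
  obtain ⟨y₀⟩ := ‹Nonempty Y›
  -- the orbit of `y₀`, extended to negative times by a constant so that it is continuous on `ℝ`
  set γ : ℝ → Y := fun s => φ (max s 0) y₀ with hγ
  have hγc : Continuous γ :=
    (horb y₀).comp_continuous (continuous_id.max continuous_const) fun s =>
      mem_Ici.2 (le_max_right _ _)
  have hγs : ∀ s t, 0 ≤ s → 0 ≤ t → φ t (γ s) = γ (s + t) := by
    intro s t hs ht
    simp only [hγ, max_eq_left hs, max_eq_left (add_nonneg hs ht), hadd s t y₀ hs ht]
  -- the uniform distribution on the orbit segment of length `k + 1`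
  set ρ : ℕ → Measure ℝ := fun k => cond volume (Ioc 0 ((k : ℝ) + 1)) with hρ
  have hk : ∀ k : ℕ, (0:ℝ) < (k:ℝ) + 1 := fun k => by positivity
  have hρp : ∀ k, IsProbabilityMeasure (ρ k) := fun k =>
    cond_isProbabilityMeasure_of_finite (by simp [Real.volume_Ioc, hk k]) (by simp)
  have hνp : ∀ k, IsProbabilityMeasure ((ρ k).map γ) := fun k =>
    Measure.isProbabilityMeasure_map hγc.aemeasurable
  set ν : ℕ → ProbabilityMeasure Y := fun k => ⟨(ρ k).map γ, hνp k⟩ with hν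
  have hint : ∀ (k : ℕ) (g : Y → ℝ), Continuous g →
      ∫ y, g y ∂(ν k : Measure Y) = ((k:ℝ) + 1)⁻¹ * ∫ s in (0:ℝ)..((k:ℝ) + 1), g (γ s) := by
    intro k g hg
    change ∫ y, g y ∂((ρ k).map γ) = _
    rw [integral_map hγc.aemeasurable hg.aestronglyMeasurable]
    simp only [hρ, ProbabilityTheory.cond, integral_smul_measure, Real.volume_Ioc, sub_zero,
      intervalIntegral.integral_of_le (hk k).le, ENNReal.toReal_inv,
      ENNReal.toReal_ofReal (hk k).le, smul_eq_mul]
  obtain ⟨μ, -, hμ⟩ := isCompact_univ.ultrafilter_le_nhds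
    (f := (hyperfilter ℕ : Ultrafilter ℕ).map ν) (by simp)
  have hlim : Tendsto ν (hyperfilter ℕ : Filter ℕ) (𝓝 μ) := hμ
  refine ⟨μ, fun t ht f => ?_⟩
  have hconv := ProbabilityMeasure.tendsto_iff_forall_integral_tendsto.1 hlim
  have hft := hconv (f.compContinuous ⟨φ t, hcont t ht⟩)
  have hd := hft.sub (hconv f)
  have h0 : Tendsto (fun k => ∫ y, f.compContinuous ⟨φ t, hcont t ht⟩ y ∂(ν k : Measure Y)
      - ∫ y, f y ∂(ν k : Measure Y)) (hyperfilter ℕ : Filter ℕ) (𝓝 0) := by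
    refine Tendsto.mono_left ?_ (Nat.hyperfilter_le_atTop)
    refine squeeze_zero_norm (a := fun k : ℕ => 2 * ‖f‖ * t * (1 / ((k:ℝ) + 1))) (fun k => ?_) ?_
    · rw [hint k _ (f.compContinuous _).continuous, hint k _ f.continuous, ← mul_sub, norm_mul,
        norm_inv, Real.norm_of_nonneg (hk k).le]
      have e : (∫ s in (0:ℝ)..((k:ℝ) + 1), f.compContinuous ⟨φ t, hcont t ht⟩ (γ s))
          = ∫ s in (0:ℝ)..((k:ℝ) + 1), f (γ (s + t)) := by
        refine intervalIntegral.integral_congr fun s hs => ?_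
        rw [uIcc_of_le (hk k).le] at hs
        simp [hγs s t hs.1 ht]
      rw [e, mul_comm, one_div]
      exact mul_le_mul_of_nonneg_right
        (abs_intervalIntegral_shift_sub_le (h := fun s => f (γ s)) (f.continuous.comp hγc)
          (fun s => f.norm_coe_le_norm _) ht) (inv_nonneg.2 (hk k).le)
    · simpa using (tendsto_one_div_add_atTop_nhds_zero_nat (𝕜 := ℝ)).const_mul (2 * ‖f‖ * t)
  have := tendsto_nhds_unique hd h0
  simpa [sub_eq_zero] using this

/-- Conditioning an invariant measure on a set that is invariant up to a null set gives an
invariant measure. -/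
lemma measurePreserving_cond {Z : Type*} [MeasurableSpace Z] {g : Z → Z} {μ : Measure Z}
    (hg : MeasurePreserving g μ μ)
    {A : Set Z} (hA : MeasurableSet A) (hinv : g ⁻¹' A =ᵐ[μ] A) :
    MeasurePreserving g (cond μ A) (cond μ A) := by
  refine ⟨hg.measurable, ?_⟩
  ext B hB
  rw [Measure.map_apply hg.measurable hB, cond_apply hA, cond_apply hA]
  congr 1
  calc μ (A ∩ g ⁻¹' B) = μ (g ⁻¹' A ∩ g ⁻¹' B) :=
        measure_congr (hinv.symm.inter (ae_eq_refl _))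
    _ = μ (A ∩ B) := by
        rw [← preimage_inter, hg.measure_preimage (hA.inter hB).nullMeasurableSet]

lemma integral_eq_cond_add_cond_compl {μ : Measure Y} [IsProbabilityMeasure μ] {A : Set Y}
    (hA : MeasurableSet A) (f : Y →ᵇ ℝ) :
    ∫ y, f y ∂μ = μ.real A * (∫ y, f y ∂(cond μ A)) + μ.real Aᶜ * ∫ y, f y ∂(cond μ Aᶜ) := by
  have key : ∀ B : Set Y, μ.real B * (∫ y, f y ∂(cond μ B)) = ∫ y in B, f y ∂μ := by
    intro B
    simp only [ProbabilityTheory.cond, integral_smul_measure, ENNReal.toReal_inv, smul_eq_mul]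
    by_cases hB : μ B = 0
    · simp [Measure.restrict_eq_zero.2 hB, measureReal_def]
    · rw [← measureReal_def, mul_inv_cancel_left₀]
      exact (ENNReal.toReal_pos hB (measure_ne_top _ _)).ne'
  rw [key, key, integral_add_compl hA (f.integrable μ)]

/-- A continuous semiflow on a nonempty compact space has an invariant probability measure for
which every measurable forward invariant set is null or conull. It is an extreme point of the
compact set of invariant measures, viewed as functionals on bounded continuous functions. -/
theorem exists_ergodic_probabilityMeasure [CompactSpace Y] [T2Space Y] [HasOuterApproxClosed Y]
    [Nonempty Y]
    (φ : ℝ → Y → Y) (hadd : ∀ s t y, 0 ≤ s → 0 ≤ t → φ (s + t) y = φ t (φ s y))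
    (hcont : ∀ t, 0 ≤ t → Continuous (φ t))
    (horb : ∀ y, ContinuousOn (fun t => φ t y) (Ici 0)) :
    ∃ μ : Measure Y, IsProbabilityMeasure μ ∧ (∀ t, 0 ≤ t → MeasurePreserving (φ t) μ μ) ∧
      ∀ A, MeasurableSet A → (∀ t, 0 ≤ t → φ t '' A ⊆ A) → μ A = 0 ∨ μ A = 1 := by
  set I : Set (ProbabilityMeasure Y) := {μ | ∀ t, 0 ≤ t → ∀ f : Y →ᵇ ℝ,
      ∫ y, f (φ t y) ∂(μ : Measure Y) = ∫ y, f y ∂(μ : Measure Y)} with hI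
  have hIclosed : IsClosed I := by
    simp only [hI, ofPred_forall]
    refine isClosed_iInter fun t => isClosed_iInter fun ht => isClosed_iInter fun f => ?_
    exact isClosed_eq (ProbabilityMeasure.continuous_integral_boundedContinuousFunction
        (f.compContinuous ⟨φ t, hcont t ht⟩))
      (ProbabilityMeasure.continuous_integral_boundedContinuousFunction f)
  -- the topology of pointwise convergence is locally convex, and `F` is continuous for it
  set F : ProbabilityMeasure Y → ((Y →ᵇ ℝ) → ℝ) := fun μ f => ∫ y, f y ∂(μ : Measure Y) with hF
  have hFc : Continuous F := continuous_pi fun f =>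
    ProbabilityMeasure.continuous_integral_boundedContinuousFunction f
  have hFinj : Function.Injective F := by
    rintro ⟨μ, hμ⟩ ⟨ν, hν⟩ h
    apply Subtype.ext
    exact ext_of_forall_integral_eq_of_IsFiniteMeasure fun f => congrFun h f
  obtain ⟨Λ, hΛ⟩ := ((hIclosed.isCompact).image hFc).extremePoints_nonempty
    (Set.Nonempty.image F (exists_invariant_probabilityMeasure φ hadd hcont horb))
  obtain ⟨⟨μ, hμI, rfl⟩, hext⟩ := mem_extremePoints.1 hΛ
  have hinv : ∀ t, 0 ≤ t → MeasurePreserving (φ t) (μ : Measure Y) μ := fun t ht =>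
    measurePreserving_of_integral_comp_eq (hcont t ht) _ (hμI t ht)
  refine ⟨μ, inferInstance, hinv, fun A hA hφA => ?_⟩
  by_contra! hne
  have hA0 : (μ : Measure Y) A ≠ 0 := hne.1
  have hAc0 : (μ : Measure Y) Aᶜ ≠ 0 := fun h => hne.2 ((prob_compl_eq_zero_iff hA).1 h)
  -- forward invariance and preservation of measure make `A` invariant up to a null set
  have hAe : ∀ t, 0 ≤ t → φ t ⁻¹' A =ᵐ[(μ : Measure Y)] A := by
    intro t ht
    refine (ae_eq_of_subset_of_measure_ge (image_subset_iff.1 (hφA t ht)) ?_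
      hA.nullMeasurableSet (measure_ne_top _ _)).symm
    rw [(hinv t ht).measure_preimage hA.nullMeasurableSet]
  have hmem : ∀ B : Set Y, MeasurableSet B → (hB : (μ : Measure Y) B ≠ 0) →
      (∀ t, 0 ≤ t → φ t ⁻¹' B =ᵐ[(μ : Measure Y)] B) →
      (⟨cond μ B, cond_isProbabilityMeasure hB⟩ : ProbabilityMeasure Y) ∈ I := by
    intro B hBm hB hBe t ht f
    have hp := measurePreserving_cond (hinv t ht) hBm (hBe t ht)
    change ∫ y, f (φ t y) ∂(cond μ B) = ∫ y, f y ∂(cond μ B)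
    conv_rhs => rw [← hp.map_eq]
    rw [integral_map hp.aemeasurable f.continuous.aestronglyMeasurable]
  have h1 := hmem A hA hA0 hAe
  have h2 := hmem Aᶜ hA.compl hAc0 fun t ht => by
    rw [preimage_compl]; exact (hAe t ht).compl
  have hseg : F μ ∈ openSegment ℝ (F ⟨cond μ A, cond_isProbabilityMeasure hA0⟩)
      (F ⟨cond μ Aᶜ, cond_isProbabilityMeasure hAc0⟩) := by
    refine ⟨(μ : Measure Y).real A, (μ : Measure Y).real Aᶜ,
      ENNReal.toReal_pos hA0 (measure_ne_top _ _), ENNReal.toReal_pos hAc0 (measure_ne_top _ _),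
      by rw [measureReal_add_measureReal_compl hA]; simp, ?_⟩
    funext f
    exact (integral_eq_cond_add_cond_compl hA f).symm
  have heq := hFinj ((hext _ (mem_image_of_mem F h1) _ (mem_image_of_mem F h2) hseg).1)
  have : (cond μ A) Aᶜ = (μ : Measure Y) Aᶜ := by
    conv_rhs => rw [← heq]
    rfl
  rw [cond_apply hA] at this
  simp at this
  exact hAc0 this.symm

end Ergodic

/-! ### Trajectories: uniqueness, dependence on the initial state, concatenation -/

/-- A continuous function whose derivative is nonpositive off a finite set does not increase. -/
lemma le_of_hasDerivAt_nonpos_off_finite {g g' : ℝ → ℝ} {F : Set ℝ} (hF : F.Finite) {a b : ℝ}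
    (hab : a ≤ b) (hc : ContinuousOn g (Icc a b))
    (hd : ∀ t ∈ Ioo a b \ F, HasDerivAt g (g' t) t) (hn : ∀ t ∈ Ioo a b \ F, g' t ≤ 0) :
    g b ≤ g a := by
  induction F, hF using Set.Finite.induction_on generalizing a b with
  | empty =>
    simp only [sdiff_empty] at hd hn
    refine antitoneOn_of_deriv_nonpos (convex_Icc a b) hc ?_ ?_ (left_mem_Icc.2 hab)
      (right_mem_Icc.2 hab) hab
    · rw [interior_Icc]
      exact fun t ht => (hd t ht).differentiableAt.differentiableWithinAt
    · rw [interior_Icc]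
      exact fun t ht => (hd t ht).deriv ▸ hn t ht
  | @insert c F _ _ ih =>
    by_cases hcm : c ∈ Ioo a b
    · have h1 : ∀ t ∈ Ioo a c \ F, t ∈ Ioo a b \ insert c F := fun t ht =>
        ⟨⟨ht.1.1, ht.1.2.trans hcm.2⟩, by simp [ht.1.2.ne, ht.2]⟩
      have h2 : ∀ t ∈ Ioo c b \ F, t ∈ Ioo a b \ insert c F := fun t ht =>
        ⟨⟨hcm.1.trans ht.1.1, ht.1.2⟩, by simp [ht.1.1.ne', ht.2]⟩
      exact (ih hcm.2.le (hc.mono (Icc_subset_Icc_left hcm.1.le)) (fun t ht => hd t (h2 t ht))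
        fun t ht => hn t (h2 t ht)).trans
        (ih hcm.1.le (hc.mono (Icc_subset_Icc_right hcm.2.le)) (fun t ht => hd t (h1 t ht))
          fun t ht => hn t (h1 t ht))
    · have h1 : ∀ t ∈ Ioo a b \ F, t ∈ Ioo a b \ insert c F := fun t ht =>
        ⟨ht.1, by rintro (rfl | h); exacts [hcm ht.1, ht.2 h]⟩
      exact ih hab hc (fun t ht => hd t (h1 t ht)) fun t ht => hn t (h1 t ht)

namespace HamiltonianSystem

variable {n m : ℕ} {S : HamiltonianSystem n m}
  {u w v : ℝ → EuclideanSpace ℝ (Fin m)} {x x' : EuclideanSpace ℝ (Fin n)}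
  {y z : ℝ → EuclideanSpace ℝ (Fin n)} {T s t L LH : ℝ}

lemma IsTrajectory.mono (h : S.IsTrajectory u T x y) (ht : t ≤ T) :
    S.IsTrajectory u t x y := by
  obtain ⟨h0, hc, hX, F, hF, hd⟩ := h
  exact ⟨h0, hc.mono (Icc_subset_Icc_right ht), fun s hs => hX s ⟨hs.1, hs.2.trans ht⟩, F, hF,
    fun s hs => hd s ⟨⟨hs.1.1, hs.1.2.trans_le ht⟩, hs.2⟩⟩

lemma IsTrajectory.initial_mem (h : S.IsTrajectory u T x y) (hT : 0 ≤ T) : x ∈ S.X :=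
  h.1 ▸ h.2.2.1 0 (left_mem_Icc.2 hT)

lemma isTrajectory_zero (hx : x ∈ S.X) : S.IsTrajectory u 0 x fun _ => x :=
  ⟨rfl, continuousOn_const, fun _ _ => hx, ∅, finite_empty, by simp⟩

/-- Grönwall's estimate for two trajectories with the same input. -/
lemma IsTrajectory.norm_sub_le (hf : S.LipschitzDynamics L) (hu : ∀ t ∈ Ioo 0 T, u t ∈ S.U)
    (hT : 0 ≤ T) (hy : S.IsTrajectory u T x y) (hz : S.IsTrajectory u T x' z) :
    ‖y T - z T‖ ≤ Real.exp (L * T) * ‖x - x'‖ := by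
  obtain ⟨hy0, hyc, hyX, F, hF, hyd⟩ := hy
  obtain ⟨hz0, hzc, hzX, F', hF', hzd⟩ := hz
  -- the squared distance, weighted by `exp (-2 L t)`, does not increase
  have key := le_of_hasDerivAt_nonpos_off_finite (hF.union hF') hT
    (g := fun t => ‖y t - z t‖ ^ 2 * Real.exp (-(2 * L * t)))
    (g' := fun t => 2 * inner ℝ (y t - z t) (S.f (y t) (u t) - S.f (z t) (u t))
        * Real.exp (-(2 * L * t))
      + ‖y t - z t‖ ^ 2 * (Real.exp (-(2 * L * t)) * -(2 * L)))
    (((hyc.sub hzc).norm.pow 2).mul (by fun_prop)) ?_ ?_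
  · simp only [hy0, hz0, mul_zero, neg_zero, Real.exp_zero, mul_one] at key
    have h2 : ‖y T - z T‖ ^ 2 ≤ (Real.exp (L * T) * ‖x - x'‖) ^ 2 := by
      rw [Real.exp_neg, ← div_eq_mul_inv, div_le_iff₀ (Real.exp_pos _)] at key
      refine key.trans_eq ?_
      rw [mul_pow, ← Real.exp_nat_mul, mul_comm]
      congr 2
      push_cast
      ring
    exact le_of_sq_le_sq h2 (by positivity)
  · intro t ht
    have h1 := hyd t ⟨ht.1, fun h => ht.2 (Or.inl h)⟩
    have h2 := hzd t ⟨ht.1, fun h => ht.2 (Or.inr h)⟩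
    refine (h1.sub h2).norm_sq.mul ?_
    have h3 : HasDerivAt (fun t => 2 * L * t) (2 * L) t := by
      simpa using (hasDerivAt_id t).const_mul (2 * L)
    exact h3.fun_neg.exp
  · intro t ht
    have hm := Ioo_subset_Icc_self ht.1
    have h1 : inner ℝ (y t - z t) (S.f (y t) (u t) - S.f (z t) (u t)) ≤ L * ‖y t - z t‖ ^ 2 := by
      refine (real_inner_le_norm _ _).trans ?_
      have := mul_le_mul_of_nonneg_left
        (hf.2 _ (hu t ht.1) _ (hyX t hm) _ (hzX t hm)) (norm_nonneg (y t - z t))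
      linarith
    have h2 : 2 * inner ℝ (y t - z t) (S.f (y t) (u t) - S.f (z t) (u t))
        - 2 * (L * ‖y t - z t‖ ^ 2) ≤ 0 := by linarith
    have := mul_nonpos_of_nonpos_of_nonneg h2 (Real.exp_pos (-(2 * L * t))).le
    linarith

lemma φ_eq_of_isTrajectory (hf : S.LipschitzDynamics L) (hu : ∀ t ∈ Ioo 0 T, u t ∈ S.U)
    (hT : 0 ≤ T) (hy : S.IsTrajectory u T x y) : S.φ T x u = y T := by
  have hD : S.Defined T x u := ⟨y, hy⟩
  have := hD.choose_spec.norm_sub_le hf hu hT hy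
  rw [sub_self, norm_zero, mul_zero, norm_le_zero_iff, sub_eq_zero] at this
  simpa only [φ, dif_pos hD] using this

lemma Defined.exists_isTrajectory (hD : S.Defined T x u) :
    ∃ y, S.IsTrajectory u T x y ∧ S.φ T x u = y T :=
  ⟨hD.choose, hD.choose_spec, by simp only [φ, dif_pos hD]⟩

lemma Defined.φ_mem (hD : S.Defined T x u) (hT : 0 ≤ T) : S.φ T x u ∈ S.X := by
  obtain ⟨y, hy, h⟩ := hD.exists_isTrajectory
  exact h ▸ hy.2.2.1 T (right_mem_Icc.2 hT)

/-- Two trajectories can be concatenated. -/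
lemma IsTrajectory.concat (hT : 0 ≤ T) (hy : S.IsTrajectory u T x y)
    (hz : S.IsTrajectory w s (y T) z) (hv : ∀ t ∈ Ioo 0 T, v t = u t)
    (hv' : ∀ t ∈ Ioo 0 s, v (T + t) = w t) :
    S.IsTrajectory v (T + s) x fun t => if t ≤ T then y t else z (t - T) := by
  obtain ⟨hy0, hyc, hyX, F, hF, hyd⟩ := hy
  obtain ⟨hz0, hzc, hzX, F', hF', hzd⟩ := hz
  refine ⟨by simp [hT, hy0], ?_, ?_, F ∪ (fun t => t + T) '' F' ∪ {T},
    (hF.union (hF'.image _)).union (finite_singleton T), ?_⟩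
  · refine ContinuousOn.if' ?_ ?_ ?_ ?_
    · rintro t ⟨ht, hfr⟩
      have htT : t = T := by
        have : t ∈ frontier (Iic T) := hfr
        simpa using this
      subst htT
      simp only [le_refl, if_true]
      refine (hyc t (right_mem_Icc.2 hT)).mono_left (nhdsWithin_mono _ ?_)
      exact fun r hr => ⟨hr.1.1, hr.2⟩
    · rintro t ⟨ht, hfr⟩
      have htT : t = T := by
        have : t ∈ frontier (Iic T) := hfr
        simpa using this
      subst htT
      have h0s : (0:ℝ) ∈ Icc 0 s := ⟨le_rfl, by linarith [ht.2]⟩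
      have : Tendsto (fun r => z (r - t)) (𝓝[Icc 0 (t + s) ∩ {a | ¬ a ≤ t}] t) (𝓝 (z 0)) := by
        refine (hzc 0 h0s).tendsto.comp (tendsto_nhdsWithin_iff.2 ⟨?_, ?_⟩)
        · refine Tendsto.mono_left ?_ nhdsWithin_le_nhds
          have : ContinuousAt (fun r : ℝ => r - t) t := by fun_prop
          simpa [ContinuousAt] using this
        · filter_upwards [self_mem_nhdsWithin] with r hr
          have h1 := hr.1.2
          have h2 := hr.2
          simp only [mem_ofPred_eq, not_le] at h2
          constructor <;> linarith
      simpa [hz0] using this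
    · exact hyc.mono fun r hr => ⟨hr.1.1, hr.2⟩
    · refine hzc.comp (by fun_prop) fun r hr => ?_
      have h1 := hr.1.2
      have h2 := hr.2
      simp only [mem_ofPred_eq, not_le] at h2
      constructor <;> linarith
  · intro t ht
    by_cases h : t ≤ T
    · simpa only [h, if_true] using hyX t ⟨ht.1, h⟩
    · simp only [h, if_false]
      exact hzX _ ⟨by linarith, by linarith [ht.2]⟩
  · rintro t ⟨ht, hn⟩
    simp only [mem_union, mem_image, mem_singleton_iff, not_or] at hn
    obtain ⟨⟨h1, h2⟩, h3⟩ := hn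
    rcases lt_or_gt_of_ne h3 with h | h
    · have hy' := hyd t ⟨⟨ht.1, h⟩, h1⟩
      simp only [h.le, if_true, hv t ⟨ht.1, h⟩]
      refine hy'.congr_of_eventuallyEq ?_
      filter_upwards [Iio_mem_nhds h] with r hr
      simp [le_of_lt (mem_Iio.1 hr)]
    · have hm : t - T ∈ Ioo 0 s := ⟨by linarith, by linarith [ht.2]⟩
      have hz' := hzd (t - T) ⟨hm, fun hF' => h2 ⟨_, hF', by ring⟩⟩
      have hvt : v t = w (t - T) := by rw [← hv' _ hm]; congr 1; ring
      simp only [not_le.2 h, if_false, hvt]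
      refine (hz'.comp_sub_const t T).congr_of_eventuallyEq ?_
      filter_upwards [Ioi_mem_nhds h] with r hr
      simp [not_le.2 (mem_Ioi.1 hr)]

/-! ### The zero-input semiflow -/

lemma zero_input_mem (S : HamiltonianSystem n m) (T : ℝ) :
    ∀ t ∈ Ioo (0:ℝ) T, (fun _ : ℝ => (0 : EuclideanSpace ℝ (Fin m))) t ∈ S.U :=
  fun _ _ => S.zero_mem_U

lemma φ₀_mem (hzero : S.ZeroInputInvariant) (hx : x ∈ S.X) (ht : 0 ≤ t) : S.φ₀ t x ∈ S.X :=
  (hzero x hx t ht).φ_mem ht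

lemma φ₀_eq_of_isTrajectory (hf : S.LipschitzDynamics L) (ht : 0 ≤ t) (htT : t ≤ T)
    (hy : S.IsTrajectory (fun _ => 0) T x y) : S.φ₀ t x = y t :=
  φ_eq_of_isTrajectory hf (S.zero_input_mem t) ht (hy.mono htT)

lemma φ₀_zero (hf : S.LipschitzDynamics L) (hx : x ∈ S.X) : S.φ₀ 0 x = x :=
  φ₀_eq_of_isTrajectory hf le_rfl le_rfl (isTrajectory_zero hx)

lemma φ₀_of_notMem (hx : x ∉ S.X) (ht : 0 ≤ t) : S.φ₀ t x = x := by
  have : ¬ S.Defined t x (fun _ => 0) := fun ⟨y, hy⟩ => hx (hy.initial_mem ht)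
  simp only [φ₀, φ, dif_neg this]

lemma φ₀_add (hzero : S.ZeroInputInvariant) (hf : S.LipschitzDynamics L) (hx : x ∈ S.X)
    (hs : 0 ≤ s) (ht : 0 ≤ t) : S.φ₀ (s + t) x = S.φ₀ t (S.φ₀ s x) := by
  obtain ⟨y, hy⟩ := hzero x hx s hs
  have hys := φ₀_eq_of_isTrajectory hf hs le_rfl hy
  obtain ⟨z, hz⟩ := hzero _ (φ₀_mem hzero hx hs) t ht
  have hzt := φ₀_eq_of_isTrajectory hf ht le_rfl hz
  rw [hys] at hz
  have hc := hy.concat hs hz (v := fun _ => 0) (fun _ _ => rfl) (fun _ _ => rfl)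
  rw [φ₀_eq_of_isTrajectory hf (add_nonneg hs ht) le_rfl hc, hzt]
  by_cases h0 : t = 0
  · subst h0; simp [hz.1]
  · simp [lt_of_le_of_ne ht (Ne.symm h0)]

lemma continuousOn_φ₀ (hzero : S.ZeroInputInvariant) (hf : S.LipschitzDynamics L) (ht : 0 ≤ t) :
    ContinuousOn (S.φ₀ t) S.X := by
  refine LipschitzOnWith.continuousOn (K := (Real.exp (L * t)).toNNReal) ?_
  refine LipschitzOnWith.of_dist_le_mul fun x hx x' hx' => ?_
  obtain ⟨y, hy, hyt⟩ := (hzero x hx t ht).exists_isTrajectory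
  obtain ⟨z, hz, hzt⟩ := (hzero x' hx' t ht).exists_isTrajectory
  rw [dist_eq_norm, dist_eq_norm, Real.coe_toNNReal _ (Real.exp_pos _).le]
  change ‖S.φ t x _ - S.φ t x' _‖ ≤ _
  rw [hyt, hzt]
  exact hy.norm_sub_le hf (S.zero_input_mem t) ht hz

lemma measurable_φ₀ (hzero : S.ZeroInputInvariant) (hf : S.LipschitzDynamics L) (ht : 0 ≤ t) :
    Measurable (S.φ₀ t) := by
  classical
  have h : S.φ₀ t = S.X.piecewise (S.φ₀ t) id := by
    funext x
    by_cases hx : x ∈ S.X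
    · simp [hx]
    · simp [hx, φ₀_of_notMem hx ht]
  rw [h]
  exact (continuousOn_φ₀ hzero hf ht).measurable_piecewise continuousOn_id
    S.isCompact_X.measurableSet

lemma continuousOn_φ₀_time (hzero : S.ZeroInputInvariant) (hf : S.LipschitzDynamics L)
    (hx : x ∈ S.X) : ContinuousOn (fun t => S.φ₀ t x) (Ici 0) := by
  intro t ht
  have ht : 0 ≤ t := ht
  obtain ⟨y, hy⟩ := hzero x hx (t + 1) (by linarith)
  have hc : ContinuousWithinAt y (Icc 0 (t + 1)) t := hy.2.1 t ⟨ht, by linarith⟩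
  have hc' : ContinuousWithinAt (fun t => S.φ₀ t x) (Icc 0 (t + 1)) t :=
    hc.congr (fun r hr => φ₀_eq_of_isTrajectory hf hr.1 hr.2 hy)
      (φ₀_eq_of_isTrajectory hf ht (by linarith) hy)
  refine hc'.mono_of_mem_nhdsWithin ?_
  filter_upwards [self_mem_nhdsWithin, mem_nhdsWithin_of_mem_nhds (Iio_mem_nhds (lt_add_one t))]
    with r hr hr'
  exact ⟨hr, le_of_lt hr'⟩

/-- The zero-input vector field is orthogonal to the gradient of the energy, because `J` is
skew-symmetric. -/
lemma inner_gradient_f_zero (hx : x ∈ S.X) : inner ℝ (gradient S.H x) (S.f x 0) = 0 := by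
  set g := (gradient S.H x).ofLp with hg
  have h1 : inner ℝ (gradient S.H x) (S.f x 0) = ((S.J x).mulVec g) ⬝ᵥ g := by
    rw [EuclideanSpace.inner_eq_star_dotProduct]
    simp [f, hg]
  have h2 : ((S.J x).mulVec g) ⬝ᵥ g = -(((S.J x).mulVec g) ⬝ᵥ g) := by
    conv_lhs => rw [dotProduct_comm, Matrix.dotProduct_mulVec, ← Matrix.mulVec_transpose,
      S.skew_J x hx, Matrix.neg_mulVec, neg_dotProduct]
  rw [h1]
  linarith

lemma BoundedGradient.continuousOn (hH : S.BoundedGradient LH) : ContinuousOn S.H S.X :=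
  fun x hx => (hH.2.1 x hx).continuousAt.continuousWithinAt

/-- The energy is conserved along zero-input trajectories. -/
lemma H_φ₀ (hzero : S.ZeroInputInvariant) (hH : S.BoundedGradient LH) (hx : x ∈ S.X)
    (ht : 0 ≤ t) : S.H (S.φ₀ t x) = S.H x := by
  obtain ⟨y, ⟨hy0, hyc, hyX, F, hF, hyd⟩, hyt⟩ := (hzero x hx t ht).exists_isTrajectory
  have hc : ContinuousOn (fun s => S.H (y s)) (Icc 0 t) := hH.continuousOn.comp hyc hyX
  have hd : ∀ s ∈ Ioo 0 t \ F, HasDerivAt (fun s => S.H (y s)) 0 s := by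
    intro s hs
    have hsX := hyX s (Ioo_subset_Icc_self hs.1)
    have h1 := (hH.2.1 _ hsX).hasGradientAt.hasFDerivAt.comp_hasDerivAt s (hyd s hs)
    rwa [InnerProductSpace.toDual_apply_apply, inner_gradient_f_zero hsX] at h1
  have e1 := le_of_hasDerivAt_nonpos_off_finite hF ht hc hd (fun _ _ => le_rfl)
  have e2 := le_of_hasDerivAt_nonpos_off_finite hF ht hc.neg
    (fun s hs => (hd s hs).neg) (fun _ _ => by simp)
  simp only [Pi.neg_apply, neg_le_neg_iff] at e2
  change S.H (S.φ t x _) = _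
  rw [hyt, ← hy0]
  exact le_antisymm e1 e2

lemma isClosed_layer (hH : S.BoundedGradient LH) (E : ℝ) : IsClosed (S.layer E) :=
  hH.continuousOn.preimage_isClosed_of_isClosed S.isCompact_X.isClosed isClosed_singleton

/-- Every zero-input trajectory enters an open set that meets all ergodic components of its energy
layer: the closure of the trajectory carries an ergodic measure, whose support is an ergodic
component. -/
theorem exists_φ₀_mem_of_meets_components (hzero : S.ZeroInputInvariant)
    (hH : S.BoundedGradient LH) (hf : S.LipschitzDynamics L) (hx : x ∈ S.X)
    {O : Set (EuclideanSpace ℝ (Fin n))} (hO : IsOpen O)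
    (hmeet : ∀ C, S.IsErgodicComponent (S.H x) C → (O ∩ C).Nonempty) :
    ∃ t, 0 < t ∧ S.φ₀ t x ∈ O := by
  -- starting at time `1` makes sure that the set is entered at a positive time
  set R := (fun t => S.φ₀ t x) '' Ici 1 with hR
  set C := closure R with hC
  have hRlayer : R ⊆ S.layer (S.H x) := by
    rintro _ ⟨t, ht, rfl⟩
    have ht : (0:ℝ) ≤ t := zero_le_one.trans ht
    exact ⟨φ₀_mem hzero hx ht, H_φ₀ hzero hH hx ht⟩
  have hClayer : C ⊆ S.layer (S.H x) := closure_minimal hRlayer (isClosed_layer hH _)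
  have hCX : C ⊆ S.X := hClayer.trans fun z hz => hz.1
  have hCmap : ∀ t, 0 ≤ t → MapsTo (S.φ₀ t) C C := by
    intro t ht
    refine MapsTo.closure_of_continuousOn ?_ ((continuousOn_φ₀ hzero hf ht).mono hCX)
    rintro _ ⟨s, hs, rfl⟩
    have hs : (1:ℝ) ≤ s := hs
    exact ⟨s + t, mem_Ici.2 (by linarith), φ₀_add hzero hf hx (zero_le_one.trans hs) ht⟩
  have hCcomp : IsCompact C := S.isCompact_X.of_isClosed_subset isClosed_closure hCX
  have : CompactSpace C := isCompact_iff_compactSpace.1 hCcomp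
  have : Nonempty C := ⟨⟨_, subset_closure (mem_image_of_mem _ (mem_Ici.2 le_rfl))⟩⟩
  -- negative times are irrelevant and act trivially
  set ψ : ℝ → C → C := fun t z => if h : 0 ≤ t then ⟨S.φ₀ t z, hCmap t h z.2⟩ else z with hψ
  have hψv : ∀ t, 0 ≤ t → ∀ z, (ψ t z : EuclideanSpace ℝ (Fin n)) = S.φ₀ t z := by
    intro t ht z
    simp [hψ, ht]
  obtain ⟨μ, hμp, hμi, hμe⟩ := exists_ergodic_probabilityMeasure ψ
    (fun s t z hs ht => Subtype.ext (by
      rw [hψv _ (add_nonneg hs ht), hψv _ ht, hψv _ hs, φ₀_add hzero hf (hCX z.2) hs ht]))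
    (fun t ht => by
      rw [continuous_induced_rng]
      refine (((continuousOn_φ₀ hzero hf ht).mono hCX).domRestrict).congr fun z => ?_
      simp [hψv t ht])
    (fun z => by
      rw [Topology.IsInducing.subtypeVal.continuousOn_iff]
      exact (continuousOn_φ₀_time hzero hf (hCX z.2)).congr fun t ht => hψv t ht z)
  have hval : Measurable (Subtype.val : C → EuclideanSpace ℝ (Fin n)) := measurable_subtype_coe
  have hCc : (μ.map Subtype.val) Cᶜ = 0 := by
    rw [Measure.map_apply hval isClosed_closure.measurableSet.compl]
    rw [preimage_compl, hC.symm, Subtype.coe_preimage_self, compl_univ, measure_empty]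
  have herg : S.IsErgodicMeasure (S.H x) (μ.map Subtype.val) := by
    refine ⟨Measure.isProbabilityMeasure_map hval.aemeasurable,
      measure_mono_null (compl_subset_compl.2 hClayer) hCc, fun t ht => ?_, ?_⟩
    · refine ⟨measurable_φ₀ hzero hf ht, ?_⟩
      have : S.φ₀ t ∘ Subtype.val = Subtype.val ∘ ψ t := funext fun z => (hψv t ht z).symm
      rw [Measure.map_map (measurable_φ₀ hzero hf ht) hval, this,
        ← Measure.map_map hval (hμi t ht).measurable, (hμi t ht).map_eq]
    · intro A hA _ hinv
      rw [Measure.map_apply hval hA]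
      refine hμe _ (hval hA) fun t ht => ?_
      rintro _ ⟨z, hz, rfl⟩
      rw [mem_preimage, hψv t ht]
      exact hinv t ht (mem_image_of_mem _ hz)
  obtain ⟨z, hzO, hz⟩ := hmeet _ ⟨_, herg, rfl⟩
  have hzC : z ∈ C := Measure.support_subset_of_isClosed isClosed_closure
    (mem_ae_iff.2 hCc) hz
  obtain ⟨_, hO', t, ht, rfl⟩ := mem_closure_iff.1 hzC O hO hzO
  exact ⟨t, zero_lt_one.trans_le ht, hO'⟩

end HamiltonianSystem

/-! ### The energy distance -/

namespace HamiltonianSystem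

variable {n m : ℕ} {S : HamiltonianSystem n m} {Stgt : Set (EuclideanSpace ℝ (Fin n))}
  {x x' : EuclideanSpace ℝ (Fin n)} {L LH ε : ℝ}

lemma ΔH_sub_le (hH : S.BoundedGradient LH) (hx : x ∈ S.X) (hx' : x' ∈ S.X) :
    S.ΔH Stgt x - S.ΔH Stgt x' ≤ LH * ‖x - x'‖ := by
  refine le_trans ?_ (hH.2.2.2.2 x hx x' hx')
  have := abs_sub_abs_le_abs_sub (S.H x - (S.Hmax Stgt + S.Hmin Stgt) / 2)
    (S.H x' - (S.Hmax Stgt + S.Hmin Stgt) / 2)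
  rw [sub_sub_sub_cancel_right] at this
  simp only [ΔH]
  linarith

lemma ΔH_congr (h : S.H x = S.H x') : S.ΔH Stgt x = S.ΔH Stgt x' := by
  simp only [ΔH, h]

lemma neg_le_ΔH (x : EuclideanSpace ℝ (Fin n)) :
    -((S.Hmax Stgt - S.Hmin Stgt) / 2) ≤ S.ΔH Stgt x := by
  have := abs_nonneg (S.H x - (S.Hmax Stgt + S.Hmin Stgt) / 2)
  simp only [ΔH]
  linarith

lemma H_mem_Ioo_of_mem_band (hε : 0 < ε) (hx : x ∈ S.band Stgt ε) :
    S.H x ∈ Ioo (S.Hmin Stgt) (S.Hmax Stgt) := by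
  have h := hx.2
  simp only [ΔH] at h
  have h' : |S.H x - (S.Hmax Stgt + S.Hmin Stgt) / 2| < (S.Hmax Stgt - S.Hmin Stgt) / 2 := by
    linarith
  rw [abs_lt] at h'
  constructor <;> linarith [h'.1, h'.2]

lemma le_sSup_ΔH (hH : S.BoundedGradient LH) {S₀ : Set (EuclideanSpace ℝ (Fin n))}
    (hS₀ : IsCompact S₀) (hS₀X : S₀ ⊆ S.X) (hx : x ∈ S₀) :
    S.ΔH Stgt x ≤ sSup (S.ΔH Stgt '' S₀) := by
  refine le_csSup (hS₀.image_of_continuousOn ?_).bddAbove (mem_image_of_mem _ hx)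
  have := hH.continuousOn.mono hS₀X
  unfold ΔH
  fun_prop

end HamiltonianSystem

/-! ### The chain policy -/

namespace AssignmentSet

open HamiltonianSystem

variable {n m : ℕ} {S : HamiltonianSystem n m} {K : AssignmentSet S}
  {ι : EuclideanSpace ℝ (Fin n) → Option (Fin K.N)}
  {S₀ Stgt : Set (EuclideanSpace ℝ (Fin n))} {x : EuclideanSpace ℝ (Fin n)}
  {L LH v₀ ε δ r s t : ℝ} {k : ℕ} {i : Fin K.N}

lemma isClosed_supp : IsClosed K.supp :=
  isClosed_iUnion_of_finite fun _ => Metric.isClosed_closedBall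

/-- A minimizer of the normalized distance at a state of the support has that state in its ball. -/
lemma mem_closedBall_of_minimizer (hx : x ∈ K.supp)
    (hi : ∀ j, ‖x - K.center i‖ / K.radius i ≤ ‖x - K.center j‖ / K.radius j) :
    x ∈ Metric.closedBall (K.center i) (K.radius i) := by
  obtain ⟨j, hj⟩ := mem_iUnion.1 hx
  rw [mem_closedBall_iff_norm] at hj ⊢
  rw [← div_le_one (K.radius_pos i)]
  exact (hi j).trans ((div_le_one (K.radius_pos j)).2 hj)

lemma IsIndexMap.exists_eq_some (hι : K.IsIndexMap ι) (hx : x ∈ S.X) (hxs : x ∈ K.supp) :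
    ∃ i, ι x = some i ∧ x ∈ Metric.closedBall (K.center i) (K.radius i) := by
  obtain ⟨i, hi, hmin⟩ := (hι x hx).1 hxs
  exact ⟨i, hi, mem_closedBall_of_minimizer hxs hmin⟩

/-- A snippet lowers the energy distance from every state of its ball, at least at the rate `v₀`:
by Grönwall's estimate the energy at the end differs from the one reached from the center by at
most `LH * r * exp (L * τ)`, and the energies at the start differ by at most `LH * r`. -/
lemma ΔH_snippet_le (hH : S.BoundedGradient LH) (hf : S.LipschitzDynamics L)
    (hexec : K.Executable) (h₁ : K.LocalDecrease Stgt LH L v₀) (hx : x ∈ S.X)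
    (hxi : x ∈ Metric.closedBall (K.center i) (K.radius i)) :
    S.ΔH Stgt (S.φ (K.duration i) x (K.signal i)) ≤ S.ΔH Stgt x - v₀ * K.duration i := by
  have hτ := (K.duration_pos i).le
  have hci : K.center i ∈ S.X ∩ Metric.closedBall (K.center i) (K.radius i) :=
    ⟨K.center_mem i, Metric.mem_closedBall_self (K.radius_pos i).le⟩
  have hDx := hexec i x ⟨hx, hxi⟩
  have hDc := hexec i _ hci
  obtain ⟨y, hy, hye⟩ := hDx.exists_isTrajectory
  obtain ⟨z, hz, hze⟩ := hDc.exists_isTrajectory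
  have hn := hy.norm_sub_le hf (fun t ht => (K.admissible i).1 t ⟨ht.1, ht.2.le⟩) hτ hz
  rw [← hye, ← hze] at hn
  rw [mem_closedBall_iff_norm] at hxi
  have e1 := ΔH_sub_le (Stgt := Stgt) hH (hDx.φ_mem hτ) (hDc.φ_mem hτ)
  have e2 := ΔH_sub_le (Stgt := Stgt) hH (K.center_mem i) hx
  rw [norm_sub_rev] at e2
  have e3 := mul_le_mul_of_nonneg_left
    (hn.trans (mul_le_mul_of_nonneg_left hxi (Real.exp_pos (L * K.duration i)).le)) hH.1.le
  have e4 := mul_le_mul_of_nonneg_left hxi hH.1.le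
  have e5 := h₁ i
  linarith

lemma policy_of_some (hi : ι x = some i) : K.policy ι x = K.signal i := by
  simp only [policy, hi]

lemma policy_of_none (hi : ι x = none) : K.policy ι x = fun _ => 0 := by
  simp only [policy, hi]

lemma dwell_of_some (hi : ι x = some i) : K.dwell ι x = ENNReal.ofReal (K.duration i) := by
  simp only [dwell, hi]

lemma dwell_of_none (hi : ι x = none) :
    K.dwell ι x = ⨅ (t : ℝ) (_ : 0 < t ∧ S.φ₀ t x ∈ K.supp), ENNReal.ofReal t := by
  simp only [dwell, hi]

lemma policy_mem (hr : 0 < r) (hrd : ENNReal.ofReal r ≤ K.dwell ι x) :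
    K.policy ι x r ∈ S.U := by
  rcases h : ι x with _ | i
  · rw [policy_of_none h]; exact S.zero_mem_U
  · rw [policy_of_some h]
    rw [dwell_of_some h, ENNReal.ofReal_le_ofReal_iff (K.duration_pos i).le] at hrd
    exact (K.admissible i).1 r ⟨hr, hrd⟩

/-- Off the support, either the zero-input trajectory never enters the support, or there is a first
time at which it is in the support, and this time is positive. -/
lemma dwell_eq_top_or (hzero : S.ZeroInputInvariant) (hf : S.LipschitzDynamics L)
    (hι : K.IsIndexMap ι) (hx : x ∈ S.X) (hxs : x ∉ K.supp) :
    (K.dwell ι x = ⊤ ∧ ∀ t, 0 < t → S.φ₀ t x ∉ K.supp) ∨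
      ∃ d, 0 < d ∧ K.dwell ι x = ENNReal.ofReal d ∧ S.φ₀ d x ∈ K.supp := by
  rw [dwell_of_none ((hι x hx).2 hxs)]
  by_cases hne : ∃ t, 0 < t ∧ S.φ₀ t x ∈ K.supp
  · right
    set A : Set ℝ := Ici 0 ∩ (fun t => S.φ₀ t x) ⁻¹' K.supp with hA
    have hAc : IsClosed A :=
      (continuousOn_φ₀_time hzero hf hx).preimage_isClosed_of_isClosed isClosed_Ici isClosed_supp
    have hAb : BddBelow A := ⟨0, fun t ht => ht.1⟩
    obtain ⟨t₀, ht₀, ht₀s⟩ := hne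
    have hm : sInf A ∈ A := hAc.csInf_mem ⟨t₀, ht₀.le, ht₀s⟩ hAb
    have hpos : 0 < sInf A := by
      refine lt_of_le_of_ne hm.1 fun h => hxs ?_
      have := hm.2
      rwa [mem_preimage, ← h, φ₀_zero hf hx] at this
    refine ⟨sInf A, hpos, le_antisymm (iInf₂_le _ ⟨hpos, hm.2⟩) ?_, hm.2⟩
    exact le_iInf₂ fun t ht => ENNReal.ofReal_le_ofReal (csInf_le hAb ⟨ht.1.le, ht.2⟩)
  · left
    push Not at hne
    refine ⟨?_, hne⟩
    simp only [iInf_eq_top]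
    exact fun t ht => absurd ht.2 (hne t ht.1)

/-- One step of the chain policy: the selected signal can be executed, and either the energy
distance drops by `δ`, or it is kept and the support is reached. -/
lemma chain_step (hzero : S.ZeroInputInvariant) (hH : S.BoundedGradient LH)
    (hf : S.LipschitzDynamics L) (hexec : K.Executable) (hι : K.IsIndexMap ι)
    (h₁ : K.LocalDecrease Stgt LH L v₀) (hδ : ∀ i, δ ≤ v₀ * K.duration i)
    (hx : x ∈ S.X) (hd : K.dwell ι x ≠ ⊤) :
    S.Defined (K.dwell ι x).toReal x (K.policy ι x) ∧
      ((x ∈ K.supp ∧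
          S.ΔH Stgt (S.φ (K.dwell ι x).toReal x (K.policy ι x)) ≤ S.ΔH Stgt x - δ) ∨
        (x ∉ K.supp ∧ S.φ (K.dwell ι x).toReal x (K.policy ι x) ∈ K.supp ∧
          S.ΔH Stgt (S.φ (K.dwell ι x).toReal x (K.policy ι x)) = S.ΔH Stgt x)) := by
  by_cases hxs : x ∈ K.supp
  · obtain ⟨i, hi, hxi⟩ := hι.exists_eq_some hx hxs
    rw [policy_of_some hi, dwell_of_some hi, ENNReal.toReal_ofReal (K.duration_pos i).le]
    exact ⟨hexec i x ⟨hx, hxi⟩, Or.inl ⟨hxs,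
      (ΔH_snippet_le hH hf hexec h₁ hx hxi).trans (by linarith [hδ i])⟩⟩
  · obtain ⟨h, -⟩ | ⟨d, hd0, hde, hds⟩ := dwell_eq_top_or hzero hf hι hx hxs
    · exact absurd h hd
    · rw [policy_of_none ((hι x hx).2 hxs), hde, ENNReal.toReal_ofReal hd0.le]
      exact ⟨hzero x hx d hd0.le, Or.inr ⟨hxs, hds, ΔH_congr (H_φ₀ hzero hH hx hd0.le)⟩⟩

lemma switchTime_mono (K : AssignmentSet S) (ι : EuclideanSpace ℝ (Fin n) → Option (Fin K.N))
    (x : EuclideanSpace ℝ (Fin n)) : Monotone (K.switchTime ι x) :=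
  monotone_nat_of_le_succ fun _ => le_self_add

lemma policyControl_eq (h : K.switchTime ι x k < ENNReal.ofReal t)
    (h' : ENNReal.ofReal t ≤ K.switchTime ι x (k + 1)) :
    K.policyControl ι x t
      = K.policy ι (K.switchState ι x k) (t - (K.switchTime ι x k).toReal) := by
  have hex : ∃ k, K.switchTime ι x k < ENNReal.ofReal t ∧
      ENNReal.ofReal t ≤ K.switchTime ι x (k + 1) := ⟨k, h, h'⟩
  have huniq : ∀ j l, K.switchTime ι x j < ENNReal.ofReal t →
      ENNReal.ofReal t ≤ K.switchTime ι x (l + 1) → j ≤ l := fun j l h1 h2 => by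
    by_contra! hlt
    exact absurd (h2.trans (switchTime_mono K ι x hlt)) (not_le.2 h1)
  have : hex.choose = k :=
    le_antisymm (huniq _ _ hex.choose_spec.1 h') (huniq _ _ h hex.choose_spec.2)
  rw [policyControl, dif_pos hex, this]

lemma policyControl_mem (K : AssignmentSet S)
    (ι : EuclideanSpace ℝ (Fin n) → Option (Fin K.N)) (x : EuclideanSpace ℝ (Fin n)) (t : ℝ) :
    K.policyControl ι x t ∈ S.U := by
  by_cases hex : ∃ k, K.switchTime ι x k < ENNReal.ofReal t ∧
      ENNReal.ofReal t ≤ K.switchTime ι x (k + 1)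
  · obtain ⟨k, h, h'⟩ := hex
    rw [policyControl_eq h h']
    have hfin : K.switchTime ι x k ≠ ⊤ := h.ne_top
    refine policy_mem (sub_pos.2 ((ENNReal.lt_ofReal_iff_toReal_lt hfin).1 h)) ?_
    rw [ENNReal.ofReal_sub _ ENNReal.toReal_nonneg, ENNReal.ofReal_toReal hfin,
      tsub_le_iff_left]
    exact h'
  · rw [policyControl, dif_neg hex]
    exact S.zero_mem_U

/-- A trajectory up to the `k`-th switching time is continued by the signal selected there. -/
lemma exists_isTrajectory_extend (hT : K.switchTime ι x k ≠ ⊤)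
    {y : ℝ → EuclideanSpace ℝ (Fin n)}
    (hy : S.IsTrajectory (K.policyControl ι x) (K.switchTime ι x k).toReal x y)
    (hyk : y (K.switchTime ι x k).toReal = K.switchState ι x k) (hs : 0 ≤ s)
    (hsd : ENNReal.ofReal s ≤ K.dwell ι (K.switchState ι x k))
    (hD : S.Defined s (K.switchState ι x k) (K.policy ι (K.switchState ι x k))) :
    ∃ z, S.IsTrajectory (K.policyControl ι x) ((K.switchTime ι x k).toReal + s) x z ∧
      z ((K.switchTime ι x k).toReal + s)
        = S.φ s (K.switchState ι x k) (K.policy ι (K.switchState ι x k)) := by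
  obtain ⟨w, hw, hws⟩ := hD.exists_isTrajectory
  have h0 : 0 ≤ (K.switchTime ι x k).toReal := ENNReal.toReal_nonneg
  rw [← hyk] at hw
  have hc := hy.concat h0 hw (v := K.policyControl ι x) (fun _ _ => rfl) ?_
  · refine ⟨_, hc, ?_⟩
    rw [hws]
    rcases hs.eq_or_lt with rfl | hs'
    · simp [hw.1]
    · simp [hs']
  · intro t ht
    have e : ENNReal.ofReal ((K.switchTime ι x k).toReal + t)
        = K.switchTime ι x k + ENNReal.ofReal t := by
      rw [ENNReal.ofReal_add h0 ht.1.le, ENNReal.ofReal_toReal hT]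
    rw [policyControl_eq (k := k), add_sub_cancel_left, hyk]
    · rw [e]
      exact ENNReal.lt_add_right hT (ENNReal.ofReal_pos.2 ht.1).ne'
    · rw [e]
      exact add_le_add_right ((ENNReal.ofReal_le_ofReal ht.2.le).trans hsd) _

/-- Up to every finite switching time the chain trajectory exists and its energy distance does not
exceed the initial one. -/
lemma chain_invariant (hzero : S.ZeroInputInvariant) (hH : S.BoundedGradient LH)
    (hf : S.LipschitzDynamics L) (hexec : K.Executable) (hι : K.IsIndexMap ι)
    (hv₀ : 0 < v₀) (h₁ : K.LocalDecrease Stgt LH L v₀) (hx : x ∈ S.X) (k : ℕ)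
    (hT : K.switchTime ι x k ≠ ⊤) :
    (∃ y, S.IsTrajectory (K.policyControl ι x) (K.switchTime ι x k).toReal x y ∧
      y (K.switchTime ι x k).toReal = K.switchState ι x k) ∧
    K.switchState ι x k ∈ S.X ∧ S.ΔH Stgt (K.switchState ι x k) ≤ S.ΔH Stgt x := by
  induction k with
  | zero => exact ⟨⟨_, isTrajectory_zero hx, rfl⟩, hx, le_rfl⟩
  | succ k ih =>
    obtain ⟨hTk, hdk⟩ := ENNReal.add_ne_top.1 hT
    obtain ⟨⟨y, hy, hyk⟩, hkX, hkH⟩ := ih hTk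
    obtain ⟨hD, hstep⟩ := chain_step (δ := 0) hzero hH hf hexec hι h₁
      (fun i => (mul_pos hv₀ (K.duration_pos i)).le) hkX hdk
    refine ⟨?_, hD.φ_mem ENNReal.toReal_nonneg, le_trans ?_ hkH⟩
    · have := exists_isTrajectory_extend hTk hy hyk ENNReal.toReal_nonneg
        ENNReal.ofReal_toReal_le hD
      rwa [← ENNReal.toReal_add hTk hdk] at this
    · rcases hstep with ⟨-, h⟩ | ⟨-, -, h⟩
      · exact h.trans (sub_zero _).le
      · exact h.le

/-- The chain policy eventually applies the zero input forever: any two consecutive steps contain a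
snippet, each snippet lowers the energy distance by a fixed amount, and the energy distance is
bounded below. -/
lemma exists_dwell_eq_top (hzero : S.ZeroInputInvariant) (hH : S.BoundedGradient LH)
    (hf : S.LipschitzDynamics L) (hexec : K.Executable) (hι : K.IsIndexMap ι)
    (hv₀ : 0 < v₀) (h₁ : K.LocalDecrease Stgt LH L v₀) (hx : x ∈ S.X) :
    ∃ k, K.switchTime ι x k ≠ ⊤ ∧ K.dwell ι (K.switchState ι x k) = ⊤ := by
  by_contra! hcon
  have hfin : ∀ k, K.switchTime ι x k ≠ ⊤ := by
    intro k
    induction k with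
    | zero => exact ENNReal.zero_ne_top
    | succ k ih => exact ENNReal.add_ne_top.2 ⟨ih, hcon k ih⟩
  obtain ⟨δ, hδ0, hδ⟩ : ∃ δ, 0 < δ ∧ ∀ i, δ ≤ v₀ * K.duration i := by
    rcases isEmpty_or_nonempty (Fin K.N) with h | h
    · exact ⟨1, one_pos, fun i => h.elim i⟩
    · obtain ⟨i, hi⟩ := Finite.exists_min fun i => v₀ * K.duration i
      exact ⟨_, mul_pos hv₀ (K.duration_pos i), hi⟩
  have hstep := fun k => (chain_step (Stgt := Stgt) hzero hH hf hexec hι h₁ hδ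
    (chain_invariant hzero hH hf hexec hι hv₀ h₁ hx k (hfin k)).2.1 (hcon k (hfin k))).2
  change ∀ k, (K.switchState ι x k ∈ K.supp ∧
      S.ΔH Stgt (K.switchState ι x (k + 1)) ≤ S.ΔH Stgt (K.switchState ι x k) - δ) ∨
    (K.switchState ι x k ∉ K.supp ∧ K.switchState ι x (k + 1) ∈ K.supp ∧
      S.ΔH Stgt (K.switchState ι x (k + 1)) = S.ΔH Stgt (K.switchState ι x k)) at hstep
  have htwo : ∀ k, S.ΔH Stgt (K.switchState ι x (k + 1 + 1))
      ≤ S.ΔH Stgt (K.switchState ι x k) - δ := by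
    intro k
    rcases hstep k with ⟨-, h⟩ | ⟨-, hs, h⟩ <;>
      rcases hstep (k + 1) with ⟨-, h'⟩ | ⟨hn, -, h'⟩
    · linarith
    · linarith
    · linarith
    · exact absurd hs hn
  have hlin : ∀ j : ℕ, S.ΔH Stgt (K.switchState ι x (2 * j)) ≤ S.ΔH Stgt x - j * δ := by
    intro j
    induction j with
    | zero => simp [switchState]
    | succ j ih =>
      have := htwo (2 * j)
      rw [mul_add, mul_one]
      push_cast
      linarith
  obtain ⟨j, hj⟩ := exists_nat_gt ((S.ΔH Stgt x + (S.Hmax Stgt - S.Hmin Stgt) / 2) / δ)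
  rw [div_lt_iff₀ hδ0] at hj
  have := neg_le_ΔH (S := S) (Stgt := Stgt) (K.switchState ι x (2 * j))
  linarith [hlin j]

/-- The chain policy reaches the target set from every initial state of energy distance at most
`sup_{S₀} ΔH`: the final zero-input trajectory never enters the support, so its energy cannot be a
relevant one, hence lies in the shrunken band, where zero-input trajectories reach the target. -/
theorem exists_policyControl_mem_target (hzero : S.ZeroInputInvariant)
    (hH : S.BoundedGradient LH) (hf : S.LipschitzDynamics L)
    (hcomp : S.TargetMeetsComponents Stgt) (hε : 0 < ε) (hexec : K.Executable)
    (hι : K.IsIndexMap ι) (hv₀ : 0 < v₀) (h₁ : K.LocalDecrease Stgt LH L v₀)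
    (h₂ : K.EnergyCoverage S₀ Stgt ε) (h₃ : K.ErgodicCoverage S₀ Stgt ε)
    {x₀ : EuclideanSpace ℝ (Fin n)}
    (hx₀X : x₀ ∈ S.X) (hx₀ : S.ΔH Stgt x₀ ≤ sSup (S.ΔH Stgt '' S₀)) :
    ∃ t : ℝ, 0 < t ∧ S.Defined t x₀ (K.policyControl ι x₀) ∧
      S.φ t x₀ (K.policyControl ι x₀) ∈ Stgt := by
  obtain ⟨k, hT, hd⟩ := exists_dwell_eq_top hzero hH hf hexec hι hv₀ h₁ hx₀X
  obtain ⟨⟨y, hy, hyk⟩, hkX, hkH⟩ :=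
    chain_invariant hzero hH hf hexec hι hv₀ h₁ hx₀X k hT
  set x := K.switchState ι x₀ k with hxdef
  have hxs : x ∉ K.supp := fun h => by
    obtain ⟨i, hi, -⟩ := hι.exists_eq_some hkX h
    exact ENNReal.ofReal_ne_top ((dwell_of_some hi).symm.trans hd)
  have hnever : ∀ t, 0 < t → S.φ₀ t x ∉ K.supp := by
    obtain ⟨-, h⟩ | ⟨d, -, hde, -⟩ := dwell_eq_top_or hzero hf hι hkX hxs
    · exact h
    · exact absurd (hde.symm.trans hd) ENNReal.ofReal_ne_top
  have hband : x ∈ S.band Stgt ε := by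
    by_contra hnb
    have hrel : x ∈ S.relevant S₀ Stgt ε :=
      ⟨⟨hkX, hkH.trans hx₀⟩, hnb⟩
    obtain ⟨t, ht, hts⟩ := exists_φ₀_mem_of_meets_components hzero hH hf hkX isOpen_interior
      (h₃ _ ⟨h₂ x hrel, mem_image_of_mem _ hrel⟩)
    exact hnever t ht (interior_subset hts)
  obtain ⟨s, hs, hst⟩ := exists_φ₀_mem_of_meets_components hzero hH hf hkX isOpen_interior
    (hcomp _ (H_mem_Ioo_of_mem_band hε hband))
  have hpol : K.policy ι x = fun _ => 0 := policy_of_none ((hι x hkX).2 hxs)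
  obtain ⟨z, hz, hzs⟩ := exists_isTrajectory_extend hT hy hyk hs.le (by rw [hd]; exact le_top)
    (by rw [← hxdef, hpol]; exact hzero x hkX s hs.le)
  have hpos : 0 < (K.switchTime ι x₀ k).toReal + s :=
    add_pos_of_nonneg_of_pos ENNReal.toReal_nonneg hs
  refine ⟨_, hpos, ⟨z, hz⟩, ?_⟩
  rw [φ_eq_of_isTrajectory hf (fun t _ => policyControl_mem K ι x₀ t) hpos.le hz, hzs, ← hxdef,
    hpol]
  exact interior_subset hst

end AssignmentSet

theorem mainTheorem1 {n m : ℕ} (S : HamiltonianSystem n m)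
    (hzero : S.ZeroInputInvariant)
    (LH : ℝ) (hH : S.BoundedGradient LH)
    (L : ℝ) (hf : S.LipschitzDynamics L)
    (S₀ Stgt : Set (EuclideanSpace ℝ (Fin n)))
    (hS₀ : IsCompact S₀) (hS₀X : S₀ ⊆ S.X)
    (hStgt : IsCompact Stgt) (hStgt' : IsConnected Stgt) (hStgtX : Stgt ⊆ S.X)
    (hcomp : S.TargetMeetsComponents Stgt)
    (ε : ℝ) (hε : 0 < ε) (hε' : ε < (S.Hmax Stgt - S.Hmin Stgt) / 2)
    (hreach : S.BandReachable Stgt ε)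
    (hrate : S.UniformPositiveRate Stgt ε)
    (K : AssignmentSet S) (hexec : K.Executable)
    (ι : EuclideanSpace ℝ (Fin n) → Option (Fin K.N)) (hι : K.IsIndexMap ι)
    (v₀ : ℝ) (hv₀ : 0 < v₀)
    (h₁ : K.LocalDecrease Stgt LH L v₀)
    (h₂ : K.EnergyCoverage S₀ Stgt ε)
    (h₃ : K.ErgodicCoverage S₀ Stgt ε) :
    ∀ᵐ x₀ ∂(volume.restrict S₀), ∃ t : ℝ, 0 < t ∧
      S.Defined t x₀ (K.policyControl ι x₀) ∧
      S.φ t x₀ (K.policyControl ι x₀) ∈ Stgt := by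
  -- the ergodic components are all met, not only almost all, so no initial state is exceptional
  filter_upwards [ae_restrict_mem hS₀.measurableSet] with x₀ hx₀
  exact AssignmentSet.exists_policyControl_mem_target hzero hH hf hcomp hε hexec hι hv₀ h₁ h₂ h₃
    (hS₀X hx₀) (HamiltonianSystem.le_sSup_ΔH hH hS₀ hS₀X hx₀)
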